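/- Let $\Bbbk$ be a field, $\otimes=\otimes_\Bbbk$, and $V^*=\mathrm{Hom}_\Bbbk(V,\Bbbk)$. A \emph{coalgebra with multiplication and unit} is a coassociative counital coalgebra $(C,\Delta,\varepsilon)$ with coalgebra maps $m:C\otimes C\to C$ and $u:\Bbbk\to C$ such that $m$ is unital with unit $u$ ($m$ need not be associative). An \emph{algebra with comultiplication and counit} is an associative unital algebra $(A,m,u)$ with algebra maps $\Delta:A\to A\otimes A$ and $\varepsilon:A\to\Bbbk$ such that $\Delta$ is counital with counit $\varepsilon$ ($\Delta$ need not be coassociative). Morphisms in both cases are the linear maps compatible with $m,u,\Delta,\varepsilon$. For a unital, not necessarily associative algebra $A$, a subspace $V\subseteq A^*$ is \emph{good} if $m^*(V)$ is contained in the image of $V\otimes V$ in $(A\otimes A)^*$; $A^\bullet\subseteq A^*$ is the sum of all good subspaces. It is a coalgebra (in general not coassociative) with $\sum f_1(a)f_2(b)=f(ab)$ and $\varepsilon(f)=f(1)$. For $A$ associative, $A^\bullet$ is the usual finite dual $A^\circ$, consisting of the functionals whose kernel contains a two-sided ideal of finite codimension. With the convolution product and unit $\varepsilon$, the assignment $C\mapsto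 C^\bullet$, $f\mapsto f^\bullet=(g\mapsto g\circ f)$ is a contravariant functor from coalgebras with multiplication and unit to algebras with comultiplication and counit, and likewise $A\mapsto A^\circ$, $f\mapsto f^\circ=(g\mapsto g\circ f)$ is a contravariant functor in the other direction. These two functors form a contravariant adjunction $\mathrm{Hom}(A,C^\bullet)\cong\mathrm{Hom}(C,A^\circ)$ with unit $\xi_A:A\to A^{\circ\bullet}$, $\xi_A(a)(f)=f(a)$, and counit $\vartheta_C:C\to C^{\bullet\circ}$, $\vartheta_C(x)(g)=g(x)$. A \emph{quasi-bialgebra} is an algebra $H$ with comultiplication and counit together with an invertible $\Phi\in H^{\otimes 3}$ (the reassociator) such that $$(H\otimes H\otimes\Delta)(\Phi)\cdot(\Delta\otimes H\otimes H)(\Phi)=(1\otimes\Phi)\cdot(H\otimes\Delta\otimes H)(\Phi)\cdot(\Phi\otimes 1),$$ $$(\varepsilon\otimes H\otimes H)(\Phi)=(H\otimes\varepsilon\otimes H)(\Phi)=(H\otimes H\otimes\varepsilon)(\Phi)=1\otimes 1,$$ $$\Phi\cdot(\Delta\otimes H)(\Delta(h))=(H\otimes\Delta)(\Delta(h))\cdot\Phi\qquad(h\in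 H);$$ a morphism $f:(H,\Phi)\to(H',\Phi')$ must satisfy $f^{\otimes 3}(\Phi)=\Phi'$. A \emph{dual quasi-bialgebra} is a coalgebra $U$ with multiplication and unit together with a convolution-invertible linear map $\omega:U^{\otimes 3}\to\Bbbk$ (the reassociator) such that, for the convolution product $*$, $$\bigl(\omega(U\otimes U\otimes m)\bigr)*\bigl(\omega(m\otimes U\otimes U)\bigr)=(\varepsilon\otimes\omega)*\bigl(\omega(U\otimes m\otimes U)\bigr)*(\omega\otimes\varepsilon),$$ $$\omega(x\otimes y\otimes z)=\varepsilon(x)\varepsilon(y)\varepsilon(z)\quad\text{whenever } 1\in\{x,y,z\},$$ $$(u\omega)*\bigl(m(m\otimes U)\bigr)=\bigl(m(U\otimes m)\bigr)*(u\omega);$$ a morphism $g:(U,\omega)\to(U',\omega')$ must satisfy $\omega'\circ g^{\otimes 3}=\omega$. Let $\zeta:(U^\bullet)^{\otimes 3}\to(U^{\otimes 3})^*$ be the canonical injection, $\zeta(f\otimes g\otimes h)(x\otimes y\otimes z)=f(x)g(y)h(z)$. A dual quasi-bialgebra $(U,\omega)$ is \emph{split} if $\omega=\zeta(\Phi)$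 for some invertible element $\Phi$ of the algebra $(U^\bullet)^{\otimes 3}$ (such a $\Phi$ is unique). Split dual quasi-bialgebras form a full subcategory of dual quasi-bialgebras. \textbf{Theorem.} The contravariant adjunction above restricts to a contravariant adjunction between split dual quasi-bialgebras and quasi-bialgebras. Precisely: (1) For every quasi-bialgebra $(H,\Phi)$, $H^\circ$ with $\omega(f\otimes g\otimes h)=\sum f(\Phi^1)g(\Phi^2)h(\Phi^3)$, where $\Phi=\sum\Phi^1\otimes\Phi^2\otimes\Phi^3$, is a dual quasi-bialgebra, and it is split; for every morphism $f$ of quasi-bialgebras, $f^\circ$ is a morphism of dual quasi-bialgebras. Hence there is a contravariant functor $(-)^\circ$ from quasi-bialgebras to split dual quasi-bialgebras. (2) For every dual quasi-bialgebra $(U,\omega)$ and every invertible $\Phi\in(U^\bullet)^{\otimes 3}$ with $\zeta(\Phi)=\omega$, $(U^\bullet,\Phi)$ is a quasi-bialgebra; for every morphism $g$ of split dual quasi-bialgebras, $g^\bullet$ is a morphism of quasi-bialgebras. Hence there is a contravariant functor $(-)^\bullet$ from split dual quasi-bialgebras to quasi-bialgebras. (3) These two functors form a contravariant adjunction whose unit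 at a quasi-bialgebra $H$ is $\xi_H$ and whose counit at a split dual quasi-bialgebra $U$ is $\vartheta_U$; in particular $\xi_H$ and $\vartheta_U$ preserve the reassociators. -/

import Mathlib

open CategoryTheory TensorProduct

universe u

namespace QuasiDual

noncomputable section

theorem dualDistrib_injective {k V W : Type*} [Field k] [AddCommGroup V] [Module k V]
    [AddCommGroup W] [Module k W] : Function.Injective (dualDistrib k V W) := by
  classical
  rw [injective_iff_map_eq_zero]
  intro t ht
  let b := Module.Basis.ofVectorSpace k (Module.Dual k W)
  obtain ⟨c, rfl⟩ := (TensorProduct.equivFinsuppOfBasisRight b).symm.surjective t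
  suffices c = 0 by simp [this]
  rw [TensorProduct.equivFinsuppOfBasisRight_symm_apply] at ht
  ext i v
  have h0 : ∑ i ∈ c.support, (c i v) • b i = 0 := by
    ext w
    have := LinearMap.congr_fun ht (v ⊗ₜ w)
    simpa [Finsupp.sum, LinearMap.sum_apply] using this
  have := linearIndependent_iff'.1 b.linearIndependent c.support (fun i => c i v) h0 i
  by_cases hi : i ∈ c.support
  · simpa using this hi
  · simp [Finsupp.notMem_support_iff.1 hi]

section FiniteDual

variable (k : Type*) [Field k] (A : Type*) [NonAssocRing A] [Module k A] [SMulCommClass k A A]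
  [IsScalarTower k A A]

/-- A subspace `S ⊆ A^*` is good if `m^*(S)` lies in the image of `S ⊗ S` in `(A ⊗ A)^*`. -/
def IsGood (S : Submodule k (Module.Dual k A)) : Prop :=
  S.map (LinearMap.mul' k A).dualMap ≤
    LinearMap.range (dualDistrib k A A ∘ₗ TensorProduct.map S.subtype S.subtype)

/-- The sum of all good subspaces of `A^*`. -/
def finiteDual : Submodule k (Module.Dual k A) := sSup {S | IsGood k A S}

variable {k A}

theorem isGood_finiteDual : IsGood k A (finiteDual k A) := by
  rw [IsGood, Submodule.map_le_iff_le_comap]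
  refine sSup_le fun S (hS : IsGood k A S) => ?_
  rw [← Submodule.map_le_iff_le_comap]
  refine le_trans hS ?_
  rintro _ ⟨t, rfl⟩
  have h : S ≤ finiteDual k A := le_sSup hS
  refine ⟨TensorProduct.map (Submodule.inclusion h) (Submodule.inclusion h) t, ?_⟩
  rw [LinearMap.comp_apply, ← LinearMap.comp_apply (TensorProduct.map _ _),
    ← TensorProduct.map_comp]
  rfl

theorem mem_finiteDual_of_comul {W : Type*} [AddCommGroup W] [Module k W]
    (θ : W →ₗ[k] Module.Dual k A) (δ : W →ₗ[k] W ⊗[k] W)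
    (h : ∀ w a b, dualDistrib k A A (TensorProduct.map θ θ (δ w)) (a ⊗ₜ b) = θ w (a * b))
    (w : W) : θ w ∈ finiteDual k A := by
  have hg : IsGood k A (LinearMap.range θ) := by
    rintro _ ⟨_, ⟨w, rfl⟩, rfl⟩
    refine ⟨TensorProduct.map θ.rangeRestrict θ.rangeRestrict (δ w), ?_⟩
    rw [LinearMap.comp_apply, ← LinearMap.comp_apply (TensorProduct.map _ _),
      ← TensorProduct.map_comp]
    ext a b
    exact h w a b
  exact (le_sSup hg : _ ≤ finiteDual k A) ⟨w, rfl⟩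

variable (k A)

/-- The finite dual `A^•`, as a type. -/
def FiniteDual : Type _ := finiteDual k A

namespace FiniteDual

instance : AddCommGroup (FiniteDual k A) := inferInstanceAs (AddCommGroup (finiteDual k A))

instance : Module k (FiniteDual k A) := inferInstanceAs (Module k (finiteDual k A))

/-- The inclusion `A^• → A^*`. -/
def toDual : FiniteDual k A →ₗ[k] Module.Dual k A := (finiteDual k A).subtype

instance : FunLike (FiniteDual k A) A k where
  coe f := toDual k A f
  coe_injective _ _ h := Subtype.ext (DFunLike.coe_injective h)

instance : LinearMapClass (FiniteDual k A) k A k where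
  map_add f := map_add (toDual k A f)
  map_smulₛₗ f := map_smul (toDual k A f)

variable {k A}

@[simp]
theorem toDual_apply (f : FiniteDual k A) (a : A) : toDual k A f a = f a := rfl

@[ext]
theorem ext {f g : FiniteDual k A} (h : ∀ a, f a = g a) : f = g := DFunLike.ext f g h

@[simp] theorem add_apply (f g : FiniteDual k A) (a : A) : (f + g) a = f a + g a := rfl

@[simp] theorem zero_apply (a : A) : (0 : FiniteDual k A) a = 0 := rfl

@[simp] theorem smul_apply (c : k) (f : FiniteDual k A) (a : A) : (c • f) a = c * f a := rfl

theorem toDual_injective : Function.Injective (toDual k A) := Subtype.val_injective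

/-- A linear map to `A^*` with values in the finite dual, as a map to `A^•`. -/
def lift {W : Type*} [AddCommGroup W] [Module k W] (θ : W →ₗ[k] Module.Dual k A)
    (h : ∀ w, θ w ∈ finiteDual k A) : W →ₗ[k] FiniteDual k A := LinearMap.codRestrict _ θ h

@[simp]
theorem lift_apply {W : Type*} [AddCommGroup W] [Module k W] (θ : W →ₗ[k] Module.Dual k A)
    (h : ∀ w, θ w ∈ finiteDual k A) (w : W) (a : A) : lift θ h w a = θ w a := rfl

variable (k A)

/-- The canonical injection `A^• ⊗ A^• → (A ⊗ A)^*`, `f ⊗ g ↦ (a ⊗ b ↦ f a * g b)`. -/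
def pair : FiniteDual k A ⊗[k] FiniteDual k A →ₗ[k] Module.Dual k (A ⊗[k] A) :=
  dualDistrib k A A ∘ₗ TensorProduct.map (toDual k A) (toDual k A)

/-- The canonical injection `ζ : (A^•)^{⊗ 3} → (A^{⊗ 3})^*`,
`f ⊗ g ⊗ h ↦ (a ⊗ b ⊗ c ↦ f a * g b * h c)`. -/
def zeta : FiniteDual k A ⊗[k] (FiniteDual k A ⊗[k] FiniteDual k A) →ₗ[k]
    Module.Dual k (A ⊗[k] (A ⊗[k] A)) :=
  dualDistrib k A (A ⊗[k] A) ∘ₗ TensorProduct.map (toDual k A) (pair k A)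

variable {k A}

@[simp]
theorem pair_tmul (f g : FiniteDual k A) (a b : A) : pair k A (f ⊗ₜ g) (a ⊗ₜ b) = f a * g b := rfl

@[simp]
theorem zeta_tmul (f g h : FiniteDual k A) (a b c : A) :
    zeta k A (f ⊗ₜ (g ⊗ₜ h)) (a ⊗ₜ (b ⊗ₜ c)) = f a * (g b * h c) := rfl

theorem pair_injective : Function.Injective (pair k A) := by
  have := Module.Free.of_divisionRing k (FiniteDual k A)
  exact dualDistrib_injective.comp
    (TensorProduct.map_injective_of_flat_flat' _ _ toDual_injective toDual_injective)

theorem zeta_injective : Function.Injective (zeta k A) := by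
  have := Module.Free.of_divisionRing k (FiniteDual k A)
  exact dualDistrib_injective.comp
    (TensorProduct.map_injective_of_flat_flat' _ _ toDual_injective pair_injective)

theorem pair_ext {s t : FiniteDual k A ⊗[k] FiniteDual k A}
    (h : ∀ a b, pair k A s (a ⊗ₜ b) = pair k A t (a ⊗ₜ b)) : s = t :=
  pair_injective (TensorProduct.ext' h)

theorem zeta_ext {s t : FiniteDual k A ⊗[k] (FiniteDual k A ⊗[k] FiniteDual k A)}
    (h : ∀ a b c, zeta k A s (a ⊗ₜ (b ⊗ₜ c)) = zeta k A t (a ⊗ₜ (b ⊗ₜ c))) : s = t := by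
  apply zeta_injective
  ext a b c
  exact h a b c

theorem mul_mem_range (f : FiniteDual k A) :
    ((LinearMap.mul' k A).dualMap ∘ₗ toDual k A) f ∈ LinearMap.range (pair k A) :=
  isGood_finiteDual ⟨_, f.2, rfl⟩

variable (k A)

/-- The comultiplication of `A^•`, characterised by `∑ f₁(a) f₂(b) = f(ab)`. -/
def comulAux : FiniteDual k A →ₗ[k] FiniteDual k A ⊗[k] FiniteDual k A :=
  (LinearEquiv.ofInjective (pair k A) pair_injective).symm.toLinearMap ∘ₗ
    LinearMap.codRestrict _ ((LinearMap.mul' k A).dualMap ∘ₗ toDual k A) mul_mem_range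

/-- The comultiplication of `A^•` is dual to the multiplication of `A`, the counit is evaluation
at `1`. -/
instance : CoalgebraStruct k (FiniteDual k A) where
  comul := comulAux k A
  counit := Module.Dual.eval k A 1 ∘ₗ toDual k A

variable {k A}

@[simp]
theorem counit_apply (f : FiniteDual k A) : CoalgebraStruct.counit (R := k) f = f 1 := rfl

@[simp]
theorem pair_comul (f : FiniteDual k A) (a b : A) :
    pair k A (CoalgebraStruct.comul (R := k) f) (a ⊗ₜ b) = f (a * b) := by
  have : pair k A (comulAux k A f) = ((LinearMap.mul' k A).dualMap ∘ₗ toDual k A) f :=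
    congrArg Subtype.val ((LinearEquiv.ofInjective (pair k A) pair_injective).apply_symm_apply
      (⟨_, mul_mem_range f⟩ : LinearMap.range (pair k A)))
  exact LinearMap.congr_fun this (a ⊗ₜ b)

theorem comul_eq {W : Type*} [AddCommGroup W] [Module k W]
    (θ : W →ₗ[k] FiniteDual k A) (δ : W →ₗ[k] W ⊗[k] W)
    (h : ∀ w a b, pair k A (TensorProduct.map θ θ (δ w)) (a ⊗ₜ b) = θ w (a * b)) (w : W) :
    CoalgebraStruct.comul (R := k) (θ w) = TensorProduct.map θ θ (δ w) :=
  pair_ext fun a b => by rw [h, pair_comul]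

theorem lid_rTensor_apply (t : FiniteDual k A ⊗[k] FiniteDual k A) (a : A) :
    TensorProduct.lid k _ (LinearMap.rTensor _ (CoalgebraStruct.counit (R := k)) t) a =
      pair k A t (1 ⊗ₜ a) := by
  induction t with
  | zero => simp
  | add x y hx hy => simp_all
  | tmul f g => simp

theorem rid_lTensor_apply (t : FiniteDual k A ⊗[k] FiniteDual k A) (a : A) :
    TensorProduct.rid k _ (LinearMap.lTensor _ (CoalgebraStruct.counit (R := k)) t) a =
      pair k A t (a ⊗ₜ 1) := by
  induction t with
  | zero => simp
  | add x y hx hy => simp_all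
  | tmul f g => simp [mul_comm]

theorem rTensor_counit : CoalgebraStruct.counit.rTensor (FiniteDual k A) ∘ₗ
    CoalgebraStruct.comul = TensorProduct.mk k k (FiniteDual k A) 1 := by
  refine LinearMap.ext fun f => (TensorProduct.lid k (FiniteDual k A)).injective ?_
  ext a
  simp [lid_rTensor_apply]

theorem lTensor_counit : CoalgebraStruct.counit.lTensor (FiniteDual k A) ∘ₗ
    CoalgebraStruct.comul = (TensorProduct.mk k (FiniteDual k A) k).flip 1 := by
  refine LinearMap.ext fun f => (TensorProduct.rid k (FiniteDual k A)).injective ?_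
  ext a
  simp [rid_lTensor_apply]

theorem zeta_assoc (t : FiniteDual k A ⊗[k] FiniteDual k A) (g : FiniteDual k A) (a b c : A) :
    zeta k A (TensorProduct.assoc k _ _ _ (t ⊗ₜ g)) (a ⊗ₜ (b ⊗ₜ c)) =
      pair k A t (a ⊗ₜ b) * g c := by
  induction t with
  | zero => simp
  | add x y hx hy => simp_all [TensorProduct.add_tmul, add_mul]
  | tmul f g => simp [mul_assoc]

theorem zeta_rTensor_comul (t : FiniteDual k A ⊗[k] FiniteDual k A) (a b c : A) :
    zeta k A (TensorProduct.assoc k _ _ _ (LinearMap.rTensor _ CoalgebraStruct.comul t))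
      (a ⊗ₜ (b ⊗ₜ c)) = pair k A t ((a * b) ⊗ₜ c) := by
  induction t with
  | zero => simp
  | add x y hx hy => simp_all
  | tmul f g => simp [zeta_assoc]

theorem zeta_lTensor_comul (t : FiniteDual k A ⊗[k] FiniteDual k A) (a b c : A) :
    zeta k A (LinearMap.lTensor _ CoalgebraStruct.comul t)
      (a ⊗ₜ (b ⊗ₜ c)) = pair k A t (a ⊗ₜ (b * c)) := by
  induction t with
  | zero => simp
  | add x y hx hy => simp_all
  | tmul f g =>
    change f a * pair k A (CoalgebraStruct.comul g) (b ⊗ₜ c) = _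
    simp

end FiniteDual

end FiniteDual

/-- The finite dual of an associative algebra is a coassociative coalgebra. -/
instance {k A : Type*} [Field k] [Ring A] [Algebra k A] : Coalgebra k (FiniteDual k A) where
  rTensor_counit_comp_comul := FiniteDual.rTensor_counit
  lTensor_counit_comp_comul := FiniteDual.lTensor_counit
  coassoc := by
    refine LinearMap.ext fun f => FiniteDual.zeta_ext fun a b c => ?_
    simp only [LinearMap.comp_apply, LinearEquiv.coe_coe]
    rw [FiniteDual.zeta_rTensor_comul, FiniteDual.zeta_lTensor_comul, FiniteDual.pair_comul,
      FiniteDual.pair_comul, mul_assoc]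

/-- The compatibilities between a unital multiplication `m, u` and a counital comultiplication
`Δ, ε` which say that `Δ` and `ε` are multiplicative and unital, equivalently that `m` and `u` are
comultiplicative and counital. Neither associativity nor coassociativity is required. -/
class NonassocBialgebra (k V : Type*) [Field k] [NonAssocRing V] [Module k V] [SMulCommClass k V V]
    [IsScalarTower k V V] [CoalgebraStruct k V] : Prop where
  rTensor_counit_comp_comul : CoalgebraStruct.counit.rTensor V ∘ₗ CoalgebraStruct.comul =
    TensorProduct.mk k k V 1
  lTensor_counit_comp_comul : CoalgebraStruct.counit.lTensor V ∘ₗ CoalgebraStruct.comul =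
    (TensorProduct.mk k V k).flip 1
  counit_one : CoalgebraStruct.counit (R := k) (1 : V) = 1
  counit_mul : ∀ x y : V, CoalgebraStruct.counit (R := k) (x * y) =
    CoalgebraStruct.counit (R := k) x * CoalgebraStruct.counit (R := k) y
  comul_one : CoalgebraStruct.comul (R := k) (1 : V) = 1 ⊗ₜ[k] 1
  comul_mul : ∀ x y : V, CoalgebraStruct.comul (R := k) (x * y) =
    CoalgebraStruct.comul (R := k) x * CoalgebraStruct.comul (R := k) y

section Convolution

variable {k : Type*} [Field k] {V : Type*} [NonAssocRing V] [Module k V] [SMulCommClass k V V]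
  [IsScalarTower k V V]

namespace FiniteDual

theorem pair_mul_aux (s t : FiniteDual k V ⊗[k] FiniteDual k V) (x x' y y' : V) :
    dualDistrib k (V ⊗[k] V) (V ⊗[k] V) (TensorProduct.map (pair k V) (pair k V)
      (TensorProduct.tensorTensorTensorComm k _ _ _ _ (s ⊗ₜ t)))
      ((x ⊗ₜ x') ⊗ₜ (y ⊗ₜ y')) = pair k V s (x ⊗ₜ y) * pair k V t (x' ⊗ₜ y') := by
  induction s with
  | zero => simp
  | add a b ha hb => simp_all [TensorProduct.add_tmul, add_mul]
  | tmul f f' =>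
    induction t with
    | zero => simp
    | add a b ha hb => simp_all [TensorProduct.tmul_add, mul_add]
    | tmul g g' => simp; ring

theorem pair_mul (f g : FiniteDual k V) (X Y : V ⊗[k] V) :
    dualDistrib k (V ⊗[k] V) (V ⊗[k] V) (TensorProduct.map (pair k V) (pair k V)
      (CoalgebraStruct.comul (f ⊗ₜ[k] g))) (X ⊗ₜ Y) = pair k V (f ⊗ₜ g) (X * Y) := by
  rw [TensorProduct.comul_tmul, AlgebraTensorModule.tensorTensorTensorComm_eq]
  induction X with
  | zero => simp
  | add a b ha hb => simp_all [TensorProduct.add_tmul, add_mul]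
  | tmul x x' =>
    induction Y with
    | zero => simp
    | add a b ha hb => simp_all [TensorProduct.tmul_add, mul_add]
    | tmul y y' => rw [pair_mul_aux]; simp

theorem eval_aux (X : V ⊗[k] V) (f g : FiniteDual k V) :
    dualDistrib k _ _ (TensorProduct.map (toDual k V).flip (toDual k V).flip X) (f ⊗ₜ g) =
      pair k V (f ⊗ₜ g) X := by
  induction X with
  | zero => simp
  | add x y hx hy => simp_all
  | tmul x y => simp

variable [CoalgebraStruct k V]

variable (k V) in
/-- The convolution product of two elements of the finite dual, as a functional. -/
def convDual : FiniteDual k V ⊗[k] FiniteDual k V →ₗ[k] Module.Dual k V :=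
  (CoalgebraStruct.comul (R := k) (A := V)).dualMap ∘ₗ pair k V

theorem convDual_apply (t : FiniteDual k V ⊗[k] FiniteDual k V) (x : V) :
    convDual k V t x = pair k V t (CoalgebraStruct.comul x) := rfl

theorem convDual_aux (a b : V)
    (t : (FiniteDual k V ⊗[k] FiniteDual k V) ⊗[k] (FiniteDual k V ⊗[k] FiniteDual k V)) :
    dualDistrib k V V (TensorProduct.map (convDual k V) (convDual k V) t) (a ⊗ₜ b) =
      dualDistrib k (V ⊗[k] V) (V ⊗[k] V) (TensorProduct.map (pair k V) (pair k V) t)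
        (CoalgebraStruct.comul a ⊗ₜ CoalgebraStruct.comul b) := by
  induction t with
  | zero => simp
  | add x y hx hy => simp_all
  | tmul s t => simp [convDual_apply]

variable [NonassocBialgebra k V]

theorem convDual_comul (w : FiniteDual k V ⊗[k] FiniteDual k V) (a b : V) :
    dualDistrib k V V (TensorProduct.map (convDual k V) (convDual k V)
      (CoalgebraStruct.comul w)) (a ⊗ₜ b) = convDual k V w (a * b) := by
  rw [convDual_aux, convDual_apply, NonassocBialgebra.comul_mul]
  induction w with
  | zero => simp
  | add x y hx hy => simp only [map_add, LinearMap.add_apply, hx, hy]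
  | tmul f g => rw [pair_mul]

variable (k V) in
/-- The convolution product of the finite dual. -/
def conv : FiniteDual k V ⊗[k] FiniteDual k V →ₗ[k] FiniteDual k V :=
  lift (convDual k V) (mem_finiteDual_of_comul _ CoalgebraStruct.comul convDual_comul)

theorem counit_mem_finiteDual :
    (CoalgebraStruct.counit : Module.Dual k V) ∈ finiteDual k V := by
  have := mem_finiteDual_of_comul (A := V)
    (LinearMap.toSpanSingleton k (Module.Dual k V) CoalgebraStruct.counit)
    (TensorProduct.mk k k k 1) (fun w a b => by
      simp [NonassocBialgebra.counit_mul]) 1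
  simpa using this

instance : Mul (FiniteDual k V) := ⟨fun f g => conv k V (f ⊗ₜ g)⟩

instance : One (FiniteDual k V) := ⟨⟨CoalgebraStruct.counit, counit_mem_finiteDual⟩⟩

theorem mul_def (f g : FiniteDual k V) : f * g = conv k V (f ⊗ₜ g) := rfl

theorem mul_apply (f g : FiniteDual k V) (x : V) :
    (f * g) x = pair k V (f ⊗ₜ g) (CoalgebraStruct.comul x) := rfl

@[simp]
theorem one_apply (x : V) : (1 : FiniteDual k V) x = CoalgebraStruct.counit (R := k) x := rfl

theorem pair_one_tmul (g : FiniteDual k V) (X : V ⊗[k] V) :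
    pair k V ((1 : FiniteDual k V) ⊗ₜ g) X =
      g (TensorProduct.lid k V (CoalgebraStruct.counit.rTensor V X)) := by
  induction X with
  | zero => simp
  | add x y hx hy => simp_all
  | tmul x y => simp

theorem pair_tmul_one (g : FiniteDual k V) (X : V ⊗[k] V) :
    pair k V (g ⊗ₜ (1 : FiniteDual k V)) X =
      g (TensorProduct.rid k V (CoalgebraStruct.counit.lTensor V X)) := by
  induction X with
  | zero => simp
  | add x y hx hy => simp_all
  | tmul x y => simp [mul_comm]

/-- The finite dual with the convolution product and unit `ε`. -/
instance : NonAssocRing (FiniteDual k V) where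
  left_distrib f g h := by
    simp only [mul_def]
    rw [← map_add, TensorProduct.tmul_add]
  right_distrib f g h := by
    simp only [mul_def]
    rw [← map_add, TensorProduct.add_tmul]
  zero_mul f := by simp [mul_def]
  mul_zero f := by simp [mul_def]
  one_mul f := by
    ext x
    have := LinearMap.congr_fun (NonassocBialgebra.rTensor_counit_comp_comul (k := k) (V := V)) x
    simp only [LinearMap.comp_apply] at this
    rw [mul_apply, pair_one_tmul, this]
    simp
  mul_one f := by
    ext x
    have := LinearMap.congr_fun (NonassocBialgebra.lTensor_counit_comp_comul (k := k) (V := V)) x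
    simp only [LinearMap.comp_apply] at this
    rw [mul_apply, pair_tmul_one, this]
    simp

instance : SMulCommClass k (FiniteDual k V) (FiniteDual k V) where
  smul_comm c f g := by
    simp only [smul_eq_mul, mul_def, TensorProduct.tmul_smul, map_smul]

instance : IsScalarTower k (FiniteDual k V) (FiniteDual k V) where
  smul_assoc c f g := by
    simp only [smul_eq_mul, mul_def, ← TensorProduct.smul_tmul', map_smul]

theorem mul'_eq : LinearMap.mul' k (FiniteDual k V) = conv k V :=
  TensorProduct.ext' fun _ _ => rfl

/-- The finite dual with convolution product and unit, and dual coproduct and counit. -/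
instance : NonassocBialgebra k (FiniteDual k V) where
  rTensor_counit_comp_comul := rTensor_counit
  lTensor_counit_comp_comul := lTensor_counit
  counit_one := by
    rw [counit_apply, one_apply, NonassocBialgebra.counit_one]
  counit_mul f g := by
    rw [counit_apply, mul_apply, NonassocBialgebra.comul_one, pair_tmul]; rfl
  comul_one := by
    refine pair_ext fun a b => ?_
    rw [pair_comul, one_apply, NonassocBialgebra.counit_mul]; rfl
  comul_mul f g := by
    rw [mul_def, comul_eq (conv k V) CoalgebraStruct.comul]
    · rw [TensorProduct.comul_tmul, AlgebraTensorModule.tensorTensorTensorComm_eq,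
        ← LinearMap.mul'_apply (R := k), LinearMap.mul'_tensor, mul'_eq]
      simp
    · intro w a b
      refine Eq.trans ?_ (convDual_comul w a b)
      simp only [pair, LinearMap.comp_apply]
      rw [← LinearMap.comp_apply (TensorProduct.map _ _), ← TensorProduct.map_comp]
      rfl

end FiniteDual

end Convolution

section Coassoc

variable {k : Type*} [Field k] {C : Type*} [NonAssocRing C] [Module k C] [SMulCommClass k C C]
  [IsScalarTower k C C] [Coalgebra k C] [NonassocBialgebra k C]

namespace FiniteDual

theorem pair_conv_left (f g h : FiniteDual k C) (X : C ⊗[k] C) :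
    pair k C ((f * g) ⊗ₜ h) X = zeta k C (f ⊗ₜ (g ⊗ₜ h))
      (TensorProduct.assoc k _ _ _ (LinearMap.rTensor _ CoalgebraStruct.comul X)) := by
  induction X with
  | zero => simp
  | add x y hx hy => simp_all
  | tmul x y =>
    rw [pair_tmul, mul_apply, LinearMap.rTensor_tmul]
    generalize CoalgebraStruct.comul (R := k) x = t
    induction t with
    | zero => simp
    | add a b ha hb => simp_all [TensorProduct.add_tmul, add_mul]
    | tmul a b => simp [mul_assoc]

theorem pair_conv_right (f g h : FiniteDual k C) (X : C ⊗[k] C) :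
    pair k C (f ⊗ₜ (g * h)) X = zeta k C (f ⊗ₜ (g ⊗ₜ h))
      (LinearMap.lTensor _ CoalgebraStruct.comul X) := by
  induction X with
  | zero => simp
  | add x y hx hy => simp_all
  | tmul x y => rfl

/-- The finite dual of a coassociative coalgebra with multiplication and unit is associative. -/
instance : Ring (FiniteDual k C) :=
  { (inferInstance : NonAssocRing (FiniteDual k C)) with
    mul_assoc := fun f g h => by
      ext x
      rw [mul_apply, mul_apply, pair_conv_left, pair_conv_right, Coalgebra.coassoc_apply] }

instance : Algebra k (FiniteDual k C) :=
  Algebra.ofModule (fun c f g => smul_mul_assoc c f g) (fun c f g => mul_smul_comm c f g)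

end FiniteDual

end Coassoc


/-- For an associative algebra the finite dual consists of the functionals whose kernel contains a
two-sided ideal of finite codimension. -/
theorem mem_finiteDual_iff {k A : Type*} [Field k] [Ring A] [Algebra k A] (f : Module.Dual k A) :
    f ∈ finiteDual k A ↔ ∃ I : Submodule k A, (∀ a, ∀ x ∈ I, a * x ∈ I ∧ x * a ∈ I) ∧
      FiniteDimensional k (A ⧸ I) ∧ I ≤ LinearMap.ker f := by
  classical
  constructor
  · intro hf
    have h2 : ∀ f : FiniteDual k A, ∃ (s : Finset (FiniteDual k A × FiniteDual k A)),
        ∀ a b, f (a * b) = ∑ i ∈ s, i.1 a * i.2 b := by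
      intro f
      obtain ⟨s, hs⟩ := TensorProduct.exists_finset (CoalgebraStruct.comul (R := k) f)
      refine ⟨s, fun a b => ?_⟩
      rw [← FiniteDual.pair_comul, hs]
      simp
    choose s hs using h2
    let f' : FiniteDual k A := ⟨f, hf⟩
    let I : Submodule k A :=
      { carrier := {b | ∀ a c, f' (a * b * c) = 0}
        add_mem' := fun {x y} hx hy a c => by
          rw [mul_add, add_mul, map_add, hx, hy, add_zero]
        zero_mem' := fun a c => by simp
        smul_mem' := fun r x hx a c => by
          rw [mul_smul_comm, smul_mul_assoc, map_smul, hx, smul_zero] }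
    refine ⟨I, fun a x hx => ⟨fun b c => ?_, fun b c => ?_⟩, ?_, fun x hx => ?_⟩
    · simpa [mul_assoc] using hx (b * a) c
    · simpa [mul_assoc] using hx b (a * c)
    · let T := (s f').biUnion fun i => s i.1
      let L : A →ₗ[k] (T → k) := LinearMap.pi fun t => FiniteDual.toDual k A t.1.2
      have hL : LinearMap.ker L ≤ I := by
        intro b hb a c
        rw [hs f']
        refine Finset.sum_eq_zero fun i hi => ?_
        rw [hs i.1]
        rw [Finset.sum_eq_zero, zero_mul]
        intro j hj
        have : (FiniteDual.toDual k A j.2) b = 0 :=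
          congrFun hb ⟨j, Finset.mem_biUnion.2 ⟨i, hi, hj⟩⟩
        rw [FiniteDual.toDual_apply] at this
        rw [this, mul_zero]
      have : FiniteDimensional k (A ⧸ LinearMap.ker L) :=
        LinearEquiv.finiteDimensional L.quotKerEquivRange.symm
      exact Module.Finite.of_surjective (Submodule.factor hL) (Submodule.factor_surjective hL)
    · have : f' x = 0 := by simpa using hx 1 1
      exact this
  · rintro ⟨I, hI, hfin, hf⟩
    let S : Submodule k (Module.Dual k A) := I.dualAnnihilator
    have hS : IsGood k A S := by
      rintro _ ⟨g, hg, rfl⟩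
      have hg' : ∀ x ∈ I, g x = 0 := (Submodule.mem_dualAnnihilator _).1 hg
      let b := Module.finBasis k (A ⧸ I)
      choose l hl using fun i => Submodule.mkQ_surjective I (b i)
      let p : ∀ i, S := fun i => ⟨b.coord i ∘ₗ I.mkQ, (Submodule.mem_dualAnnihilator _).2
        fun x hx => by simp [(Submodule.Quotient.mk_eq_zero I).2 hx]⟩
      let q : ∀ i, S := fun i => ⟨g ∘ₗ LinearMap.mulLeft k (l i),
        (Submodule.mem_dualAnnihilator _).2 fun x hx => hg' _ (hI _ _ hx).1⟩
      refine ⟨∑ i, p i ⊗ₜ q i, ?_⟩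
      ext x y
      have hx : x - ∑ i, b.repr (I.mkQ x) i • l i ∈ I := by
        rw [← Submodule.Quotient.mk_eq_zero, ← Submodule.mkQ_apply, map_sub, map_sum, sub_eq_zero]
        conv_lhs => rw [← b.sum_repr (I.mkQ x)]
        simp [← hl]
      have := hg' _ (hI y _ hx).2
      rw [sub_mul, map_sub, sub_eq_zero] at this
      simp [p, q, this, Finset.sum_mul]
    exact (le_sSup hS : S ≤ finiteDual k A) ((Submodule.mem_dualAnnihilator _).2 fun x hx => hf hx)

section Hom

/-- A linear map which is multiplicative, unital, comultiplicative and counital. -/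
structure NonassocBialgHom (k V W : Type*) [Field k] [NonAssocRing V] [Module k V]
    [CoalgebraStruct k V] [NonAssocRing W] [Module k W] [CoalgebraStruct k W]
    extends V →ₗ[k] W where
  map_one' : toLinearMap 1 = 1
  map_mul' : ∀ x y, toLinearMap (x * y) = toLinearMap x * toLinearMap y
  counit_comp' : CoalgebraStruct.counit ∘ₗ toLinearMap = CoalgebraStruct.counit
  comul_comp' : CoalgebraStruct.comul ∘ₗ toLinearMap =
    TensorProduct.map toLinearMap toLinearMap ∘ₗ CoalgebraStruct.comul

namespace NonassocBialgHom

variable {k : Type*} [Field k] {V W X : Type*}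
  [NonAssocRing V] [Module k V] [CoalgebraStruct k V]
  [NonAssocRing W] [Module k W] [CoalgebraStruct k W]
  [NonAssocRing X] [Module k X] [CoalgebraStruct k X]

instance : FunLike (NonassocBialgHom k V W) V W where
  coe f := f.toLinearMap
  coe_injective f g h := by
    cases f; cases g; congr; exact DFunLike.coe_injective h

@[simp]
theorem toLinearMap_apply (f : NonassocBialgHom k V W) (x : V) : f.toLinearMap x = f x := rfl

@[ext]
theorem ext {f g : NonassocBialgHom k V W} (h : ∀ x, f x = g x) : f = g := DFunLike.ext f g h

/-- The identity morphism. -/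
def id (k V : Type*) [Field k] [NonAssocRing V] [Module k V] [CoalgebraStruct k V] :
    NonassocBialgHom k V V where
  toLinearMap := LinearMap.id
  map_one' := rfl
  map_mul' _ _ := rfl
  counit_comp' := rfl
  comul_comp' := by rw [TensorProduct.map_id]; rfl

/-- The composition of morphisms. -/
def comp (g : NonassocBialgHom k W X) (f : NonassocBialgHom k V W) : NonassocBialgHom k V X where
  toLinearMap := g.toLinearMap ∘ₗ f.toLinearMap
  map_one' := by rw [LinearMap.comp_apply, f.map_one', g.map_one']
  map_mul' x y := by simp only [LinearMap.comp_apply, f.map_mul', g.map_mul']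
  counit_comp' := by rw [← LinearMap.comp_assoc, g.counit_comp', f.counit_comp']
  comul_comp' := by
    rw [← LinearMap.comp_assoc, g.comul_comp', LinearMap.comp_assoc, f.comul_comp',
      TensorProduct.map_comp, LinearMap.comp_assoc]

@[simp] theorem id_apply (x : V) : id k V x = x := rfl

@[simp] theorem comp_apply (g : NonassocBialgHom k W X) (f : NonassocBialgHom k V W) (x : V) :
    g.comp f x = g (f x) := rfl

end NonassocBialgHom

namespace FiniteDual

variable {k : Type*} [Field k] {V W : Type*}
  [NonAssocRing V] [Module k V] [SMulCommClass k V V] [IsScalarTower k V V] [CoalgebraStruct k V]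
  [NonAssocRing W] [Module k W] [SMulCommClass k W W] [IsScalarTower k W W] [CoalgebraStruct k W]

set_option linter.unusedSectionVars false in
theorem map_aux (f : NonassocBialgHom k V W) (t : FiniteDual k W ⊗[k] FiniteDual k W) (a b : V) :
    dualDistrib k V V (TensorProduct.map (f.toLinearMap.dualMap ∘ₗ toDual k W)
      (f.toLinearMap.dualMap ∘ₗ toDual k W) t) (a ⊗ₜ b) = pair k W t (f a ⊗ₜ f b) := by
  induction t with
  | zero => simp
  | add x y hx hy => simp_all
  | tmul g h => simp

/-- The map `f^• : W^• → V^•`, `g ↦ g ∘ f`, as a linear map. -/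
def mapLinear (f : NonassocBialgHom k V W) : FiniteDual k W →ₗ[k] FiniteDual k V :=
  lift (f.toLinearMap.dualMap ∘ₗ toDual k W) (mem_finiteDual_of_comul _ CoalgebraStruct.comul
    fun g a b => by
      rw [map_aux, pair_comul, LinearMap.comp_apply, LinearMap.dualMap_apply, f.map_mul']; rfl)

@[simp]
theorem mapLinear_apply (f : NonassocBialgHom k V W) (g : FiniteDual k W) (x : V) :
    mapLinear f g x = g (f x) := rfl

theorem pair_map (f : NonassocBialgHom k V W) (t : FiniteDual k W ⊗[k] FiniteDual k W) :
    pair k V (TensorProduct.map (mapLinear f) (mapLinear f) t) =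
      pair k W t ∘ₗ TensorProduct.map f.toLinearMap f.toLinearMap := by
  induction t with
  | zero => simp
  | add x y hx hy => simp [hx, hy, LinearMap.add_comp]
  | tmul g h => ext a b; simp

variable [NonassocBialgebra k V] [NonassocBialgebra k W]

/-- The morphism `f^• : W^• → V^•`, `g ↦ g ∘ f`, dual to `f : V → W`. -/
def map (f : NonassocBialgHom k V W) :
    NonassocBialgHom k (FiniteDual k W) (FiniteDual k V) where
  toLinearMap := mapLinear f
  map_one' := by
    ext x
    exact LinearMap.congr_fun f.counit_comp' x
  map_mul' g h := by
    ext x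
    rw [mapLinear_apply, mul_apply, mul_apply, ← TensorProduct.map_tmul, pair_map,
      LinearMap.comp_apply, ← LinearMap.comp_apply (TensorProduct.map _ _), ← f.comul_comp']
    rfl
  counit_comp' := by
    refine LinearMap.ext fun g => ?_
    have : f 1 = 1 := f.map_one'
    simp [this]
  comul_comp' := by
    refine LinearMap.ext fun g => comul_eq (mapLinear f) CoalgebraStruct.comul (fun w a b => ?_) g
    rw [pair_map, LinearMap.comp_apply, TensorProduct.map_tmul, pair_comul, mapLinear_apply]
    exact congrArg _ (f.map_mul' a b).symm

@[simp]
theorem map_apply (f : NonassocBialgHom k V W) (g : FiniteDual k W) (x : V) :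
    map f g x = g (f x) := rfl

variable (k V)

/-- Evaluation `V → V^••`, `v ↦ (f ↦ f v)`, as a linear map. -/
def evalLinear : V →ₗ[k] FiniteDual k (FiniteDual k V) :=
  lift (toDual k V).flip (mem_finiteDual_of_comul _ CoalgebraStruct.comul fun v f g => by
    rw [eval_aux, LinearMap.flip_apply, toDual_apply, mul_apply])

variable {k V}

@[simp]
theorem evalLinear_apply (v : V) (f : FiniteDual k V) : evalLinear k V v f = f v := rfl

theorem pair_eval_tmul (x y : V) (t : FiniteDual k V ⊗[k] FiniteDual k V) :
    pair k (FiniteDual k V) (evalLinear k V x ⊗ₜ evalLinear k V y) t = pair k V t (x ⊗ₜ y) := by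
  induction t with
  | zero => simp
  | add a b ha hb => simp only [map_add, LinearMap.add_apply, ha, hb]
  | tmul f g => simp

theorem pair_eval (X : V ⊗[k] V) (f g : FiniteDual k V) :
    pair k (FiniteDual k V) (TensorProduct.map (evalLinear k V) (evalLinear k V) X) (f ⊗ₜ g) =
      pair k V (f ⊗ₜ g) X := by
  induction X with
  | zero => simp
  | add x y hx hy => simp_all
  | tmul x y => simp

variable (k V)

/-- The evaluation morphism `V → V^••`, `v ↦ (f ↦ f v)`. -/
def eval : NonassocBialgHom k V (FiniteDual k (FiniteDual k V)) where
  toLinearMap := evalLinear k V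
  map_one' := by ext f; rfl
  map_mul' x y := by
    ext f
    rw [mul_apply, pair_eval_tmul, pair_comul, evalLinear_apply]
  counit_comp' := by ext x; rfl
  comul_comp' := by
    refine LinearMap.ext fun v => comul_eq (evalLinear k V) CoalgebraStruct.comul
      (fun w f g => ?_) v
    rw [pair_eval, evalLinear_apply, mul_apply]

variable {k V}

@[simp]
theorem eval_apply (v : V) (f : FiniteDual k V) : eval k V v f = f v := rfl

end FiniteDual

end Hom

section Categories

/-- A coalgebra with multiplication and unit: a coassociative counital coalgebra `C` with
coalgebra maps `m : C ⊗ C → C` and `u : k → C` such that `m` is unital with unit `u`. -/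
structure CoalgMulUnit (k : Type u) [Field k] where
  carrier : Type u
  [nonAssocRing : NonAssocRing carrier]
  [module : Module k carrier]
  [smulCommClass : SMulCommClass k carrier carrier]
  [isScalarTower : IsScalarTower k carrier carrier]
  [coalgebra : Coalgebra k carrier]
  [compat : NonassocBialgebra k carrier]

/-- An algebra with comultiplication and counit: an associative unital algebra `A` with algebra
maps `Δ : A → A ⊗ A` and `ε : A → k` such that `Δ` is counital with counit `ε`. -/
structure AlgComulCounit (k : Type u) [Field k] where
  carrier : Type u
  [ring : Ring carrier]
  [algebra : Algebra k carrier]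
  [coalgebraStruct : CoalgebraStruct k carrier]
  [compat : NonassocBialgebra k carrier]

attribute [instance] CoalgMulUnit.nonAssocRing CoalgMulUnit.module CoalgMulUnit.smulCommClass
  CoalgMulUnit.isScalarTower CoalgMulUnit.coalgebra CoalgMulUnit.compat
  AlgComulCounit.ring AlgComulCounit.algebra AlgComulCounit.coalgebraStruct AlgComulCounit.compat

variable (k : Type u) [Field k]

instance : CoeSort (CoalgMulUnit k) (Type u) := ⟨CoalgMulUnit.carrier⟩

instance : CoeSort (AlgComulCounit k) (Type u) := ⟨AlgComulCounit.carrier⟩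

instance : Category (CoalgMulUnit k) where
  Hom C D := NonassocBialgHom k C D
  id C := NonassocBialgHom.id k C
  comp f g := g.comp f

instance : Category (AlgComulCounit k) where
  Hom A B := NonassocBialgHom k A B
  id A := NonassocBialgHom.id k A
  comp f g := g.comp f

/-- The contravariant functor `C ↦ C^•` from coalgebras with multiplication and unit to algebras
with comultiplication and counit. -/
def bullet : (CoalgMulUnit k)ᵒᵖ ⥤ AlgComulCounit k where
  obj C := ⟨FiniteDual k C.unop⟩
  map f := FiniteDual.map (V := _) (W := _) f.unop
  map_id _ := rfl
  map_comp _ _ := rfl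

/-- The contravariant functor `A ↦ A^∘` from algebras with comultiplication and counit to
coalgebras with multiplication and unit. -/
def circ : (AlgComulCounit k)ᵒᵖ ⥤ CoalgMulUnit k where
  obj A := ⟨FiniteDual k A.unop⟩
  map f := FiniteDual.map (V := _) (W := _) f.unop
  map_id _ := rfl
  map_comp _ _ := rfl

/-- The contravariant adjunction between `(-)^∘` and `(-)^•`, with unit `ξ_A : A → A^∘•` and counit
`ϑ_C : C → C^•∘` given by evaluation. -/
def finiteDualAdjunction : (circ k).rightOp ⊣ bullet k where
  unit :=
    { app := fun A => FiniteDual.eval k A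
      naturality := fun _ _ _ => rfl }
  counit :=
    { app := fun C => Quiver.Hom.op (X := C.unop) (FiniteDual.eval k C.unop)
      naturality := fun _ _ _ => rfl }
  left_triangle_components _ := rfl
  right_triangle_components _ := rfl

end Categories

section Reassociators

/-- `f^{⊗ 3}`. -/
abbrev tensorCube {k V W : Type*} [Field k] [AddCommGroup V] [Module k V] [AddCommGroup W]
    [Module k W] (f : V →ₗ[k] W) : V ⊗[k] (V ⊗[k] V) →ₗ[k] W ⊗[k] (W ⊗[k] W) :=
  TensorProduct.map f (TensorProduct.map f f)

open CoalgebraStruct in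
/-- `Φ` is a reassociator (a counital 3-cocycle) for an algebra `H` with comultiplication and
counit. Triple and fourfold tensor powers are bracketed to the right. -/
structure IsReassociator (k H : Type*) [Field k] [Ring H] [Algebra k H] [CoalgebraStruct k H]
    (Φ : H ⊗[k] (H ⊗[k] H)) : Prop where
  isUnit : IsUnit Φ
  /-- `(H ⊗ H ⊗ Δ)(Φ) · (Δ ⊗ H ⊗ H)(Φ) = (1 ⊗ Φ) · (H ⊗ Δ ⊗ H)(Φ) · (Φ ⊗ 1)` -/
  cocycle :
    LinearMap.lTensor H (LinearMap.lTensor H comul) Φ *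
      TensorProduct.assoc k H H (H ⊗[k] H) (LinearMap.rTensor (H ⊗[k] H) comul Φ) =
    (1 ⊗ₜ[k] Φ) *
      LinearMap.lTensor H
        ((TensorProduct.assoc k H H H).toLinearMap ∘ₗ LinearMap.rTensor H comul) Φ *
      LinearMap.lTensor H (TensorProduct.assoc k H H H).toLinearMap
        (TensorProduct.assoc k H (H ⊗[k] H) H (Φ ⊗ₜ[k] 1))
  /-- `(ε ⊗ H ⊗ H)(Φ) = 1 ⊗ 1` -/
  counit_left : TensorProduct.lid k (H ⊗[k] H) (LinearMap.rTensor (H ⊗[k] H) counit Φ) = 1 ⊗ₜ[k] 1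
  /-- `(H ⊗ ε ⊗ H)(Φ) = 1 ⊗ 1` -/
  counit_middle : LinearMap.lTensor H
    ((TensorProduct.lid k H).toLinearMap ∘ₗ LinearMap.rTensor H counit) Φ = 1 ⊗ₜ[k] 1
  /-- `(H ⊗ H ⊗ ε)(Φ) = 1 ⊗ 1` -/
  counit_right : LinearMap.lTensor H
    ((TensorProduct.rid k H).toLinearMap ∘ₗ LinearMap.lTensor H counit) Φ = 1 ⊗ₜ[k] 1
  /-- `Φ · (Δ ⊗ H)(Δ(h)) = (H ⊗ Δ)(Δ(h)) · Φ` -/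
  quasi_coassoc : ∀ h : H,
    Φ * TensorProduct.assoc k H H H (LinearMap.rTensor H comul (comul h)) =
      LinearMap.lTensor H comul (comul h) * Φ

open CoalgebraStruct LinearMap WithConv in
/-- `ω` is a reassociator (a unital 3-cocycle) for a coalgebra `U` with multiplication and unit.
`toConv` marks elements of the convolution algebras. -/
structure IsDualReassociator (k U : Type*) [Field k] [NonAssocRing U] [Module k U]
    [SMulCommClass k U U] [IsScalarTower k U U] [Coalgebra k U]
    (ω : U ⊗[k] (U ⊗[k] U) →ₗ[k] k) : Prop where
  isUnit : IsUnit (toConv ω)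
  /-- `(ω ∘ (U ⊗ U ⊗ m)) * (ω ∘ (m ⊗ U ⊗ U)) = (ε ⊗ ω) * (ω ∘ (U ⊗ m ⊗ U)) * (ω ⊗ ε)` -/
  cocycle :
    toConv (ω ∘ₗ lTensor U (lTensor U (mul' k U))) *
      toConv (ω ∘ₗ rTensor (U ⊗[k] U) (mul' k U) ∘ₗ
        (TensorProduct.assoc k U U (U ⊗[k] U)).symm.toLinearMap) =
    toConv (mul' k k ∘ₗ TensorProduct.map counit ω) *
      toConv (ω ∘ₗ lTensor U
        (rTensor U (mul' k U) ∘ₗ (TensorProduct.assoc k U U U).symm.toLinearMap)) *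
      toConv (mul' k k ∘ₗ TensorProduct.map ω counit ∘ₗ
        (TensorProduct.assoc k U (U ⊗[k] U) U).symm.toLinearMap ∘ₗ
          lTensor U (TensorProduct.assoc k U U U).symm.toLinearMap)
  unit_left : ∀ x y : U, ω (1 ⊗ₜ (x ⊗ₜ y)) = counit (R := k) x * counit (R := k) y
  unit_middle : ∀ x y : U, ω (x ⊗ₜ (1 ⊗ₜ y)) = counit (R := k) x * counit (R := k) y
  unit_right : ∀ x y : U, ω (x ⊗ₜ (y ⊗ₜ 1)) = counit (R := k) x * counit (R := k) y
  /-- `(u ∘ ω) * (m ∘ (m ⊗ U)) = (m ∘ (U ⊗ m)) * (u ∘ ω)` -/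
  quasi_assoc :
    toConv (toSpanSingleton k U 1 ∘ₗ ω) *
      toConv (mul' k U ∘ₗ rTensor U (mul' k U) ∘ₗ
        (TensorProduct.assoc k U U U).symm.toLinearMap) =
    toConv (mul' k U ∘ₗ lTensor U (mul' k U)) * toConv (toSpanSingleton k U 1 ∘ₗ ω)

variable (k : Type u) [Field k]

/-- A quasi-bialgebra. -/
structure QuasiBialgebra where
  base : AlgComulCounit k
  Φ : base ⊗[k] (base ⊗[k] base)
  isReassociator : IsReassociator k base Φ

/-- A dual quasi-bialgebra. -/
structure DualQuasiBialgebra where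
  base : CoalgMulUnit k
  ω : base ⊗[k] (base ⊗[k] base) →ₗ[k] k
  isReassociator : IsDualReassociator k base ω

variable {k}

/-- A morphism of quasi-bialgebras: a morphism `f` of algebras with comultiplication and counit
such that `f^{⊗ 3}(Φ) = Φ'`. -/
@[ext]
structure QuasiBialgebra.Hom (H K : QuasiBialgebra k) where
  hom : H.base ⟶ K.base
  map_reassociator : tensorCube (NonassocBialgHom.toLinearMap hom) H.Φ = K.Φ

/-- A morphism of dual quasi-bialgebras: a morphism `g` of coalgebras with multiplication and unit
such that `ω' ∘ g^{⊗ 3} = ω`. -/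
@[ext]
structure DualQuasiBialgebra.Hom (U V : DualQuasiBialgebra k) where
  hom : U.base ⟶ V.base
  comp_reassociator : V.ω ∘ₗ tensorCube (NonassocBialgHom.toLinearMap hom) = U.ω

instance : Category (QuasiBialgebra k) where
  Hom := QuasiBialgebra.Hom
  id H := ⟨𝟙 H.base, by
    change tensorCube LinearMap.id H.Φ = H.Φ
    simp [tensorCube]⟩
  comp f g := ⟨f.hom ≫ g.hom, by
    rw [← g.map_reassociator, ← f.map_reassociator, ← LinearMap.comp_apply (tensorCube _),
      tensorCube, tensorCube, ← TensorProduct.map_comp, ← TensorProduct.map_comp]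
    rfl⟩

instance : Category (DualQuasiBialgebra k) where
  Hom := DualQuasiBialgebra.Hom
  id U := ⟨𝟙 U.base, by
    change U.ω ∘ₗ tensorCube LinearMap.id = U.ω
    simp [tensorCube]⟩
  comp f g := ⟨f.hom ≫ g.hom, by
    rw [← f.comp_reassociator, ← g.comp_reassociator, LinearMap.comp_assoc,
      tensorCube, tensorCube, ← TensorProduct.map_comp, ← TensorProduct.map_comp]
    rfl⟩

variable (k)

/-- The forgetful functor from quasi-bialgebras to algebras with comultiplication and counit. -/
def QuasiBialgebra.forget : QuasiBialgebra k ⥤ AlgComulCounit k where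
  obj H := H.base
  map f := f.hom

/-- The forgetful functor from dual quasi-bialgebras to coalgebras with multiplication and unit. -/
def DualQuasiBialgebra.forget : DualQuasiBialgebra k ⥤ CoalgMulUnit k where
  obj U := U.base
  map f := f.hom

variable {k}

/-- The functional `ω = η(Φ)` on `(H^∘)^{⊗ 3}`, `f ⊗ g ⊗ h ↦ ∑ f(Φ¹) g(Φ²) h(Φ³)`. -/
def QuasiBialgebra.dualω (H : QuasiBialgebra k) :
    FiniteDual k H.base ⊗[k] (FiniteDual k H.base ⊗[k] FiniteDual k H.base) →ₗ[k] k :=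
  (FiniteDual.zeta k H.base).flip H.Φ

/-- `Φ` is an invertible element of `(U^•)^{⊗ 3}` with `ζ(Φ) = ω`. -/
structure DualQuasiBialgebra.IsSplitting (U : DualQuasiBialgebra k)
    (Φ : FiniteDual k U.base ⊗[k] (FiniteDual k U.base ⊗[k] FiniteDual k U.base)) : Prop where
  isUnit : IsUnit Φ
  zeta_eq : FiniteDual.zeta k U.base Φ = U.ω

variable (k)

/-- A dual quasi-bialgebra is split if `ω = ζ(Φ)` for some invertible `Φ ∈ (U^•)^{⊗ 3}`. -/
def isSplit : ObjectProperty (DualQuasiBialgebra k) := fun U => ∃ Φ, U.IsSplitting Φ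

/-- Split dual quasi-bialgebras, as a full subcategory of dual quasi-bialgebras. -/
abbrev SplitDualQuasiBialgebra : Type _ := (isSplit k).FullSubcategory

variable {k}

/-- The element `Φ ∈ (U^•)^{⊗ 3}` with `ζ(Φ) = ω`; it is unique since `ζ` is injective. -/
def SplitDualQuasiBialgebra.Φ (U : SplitDualQuasiBialgebra k) :
    FiniteDual k U.obj.base ⊗[k] (FiniteDual k U.obj.base ⊗[k] FiniteDual k U.obj.base) :=
  U.property.choose

theorem SplitDualQuasiBialgebra.isSplitting (U : SplitDualQuasiBialgebra k) :
    U.obj.IsSplitting (SplitDualQuasiBialgebra.Φ U) := U.property.choose_spec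

theorem SplitDualQuasiBialgebra.eq_Φ (U : SplitDualQuasiBialgebra k)
    {Φ : FiniteDual k U.obj.base ⊗[k] (FiniteDual k U.obj.base ⊗[k] FiniteDual k U.obj.base)}
    (h : U.obj.IsSplitting Φ) : Φ = SplitDualQuasiBialgebra.Φ U :=
  FiniteDual.zeta_injective (h.zeta_eq.trans (SplitDualQuasiBialgebra.isSplitting U).zeta_eq.symm)

/-- The contravariant functor `(H, Φ) ↦ (H^∘, η(Φ))`, `f ↦ f^∘`, from quasi-bialgebras to dual
quasi-bialgebras, given that it is well defined on objects and on morphisms. -/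
def quasiCirc
    (hobj : ∀ H : QuasiBialgebra k, IsDualReassociator k (FiniteDual k H.base) H.dualω)
    (hmap : ∀ {H K : QuasiBialgebra k} (f : H ⟶ K),
      H.dualω ∘ₗ tensorCube (FiniteDual.map f.hom).toLinearMap = K.dualω) :
    (QuasiBialgebra k)ᵒᵖ ⥤ DualQuasiBialgebra k where
  obj H := ⟨(circ k).obj (.op H.unop.base), H.unop.dualω, hobj H.unop⟩
  map f := ⟨(circ k).map (f.unop.hom).op, hmap f.unop⟩

/-- The contravariant functor `(U, ζ(Φ)) ↦ (U^•, Φ)`, `g ↦ g^•`, from split dual quasi-bialgebras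
to quasi-bialgebras, given that it is well defined on objects and on morphisms. -/
def quasiBullet
    (hobj : ∀ (U : DualQuasiBialgebra k) Φ, U.IsSplitting Φ →
      IsReassociator k (FiniteDual k U.base) Φ)
    (hmap : ∀ {U V : SplitDualQuasiBialgebra k} (g : U ⟶ V),
      tensorCube (FiniteDual.map g.hom.hom).toLinearMap (SplitDualQuasiBialgebra.Φ V) =
        SplitDualQuasiBialgebra.Φ U) :
    (SplitDualQuasiBialgebra k)ᵒᵖ ⥤ QuasiBialgebra k where
  obj U := ⟨(bullet k).obj (.op U.unop.obj.base), SplitDualQuasiBialgebra.Φ U.unop,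
    hobj U.unop.obj _ (SplitDualQuasiBialgebra.isSplitting U.unop)⟩
  map g := ⟨(bullet k).map (g.unop.hom.hom).op, hmap g.unop⟩

end Reassociators

end

end QuasiDual

open QuasiDual

/-! Both directions come from one statement about a pairing `θ : A → C^*` between an algebra with
comultiplication and counit and a coalgebra with multiplication and unit, where each operation on
one side is dual to the matching operation on the other (`IsBialgPairing`). Such a `θ` is an algebra
map into the convolution algebra, and so are its tensor powers (`IsConvPairing.tensor`). Put `ω =
θ^{⊗3}(Φ)`. Applying tensor powers of `θ` to each side of an axiom for `Φ` gives the matching side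
of the axiom for `ω`; for quasi-coassociativity it gives the `C`-valued axiom tested against the
functionals `θ a`. Hence axioms pass from `Φ` to `ω` when `A` separates the points of `C`
(`IsBialgPairing.isDualReassociator`). They pass back when `θ` is injective, because over a field
its tensor powers are then injective too (`IsBialgPairing.isReassociator`).

The first transfer applies to the evaluation pairing of `H` with `H^∘`, the second to the inclusion
`U^• → U^*`. The dual of `H` is split by `ξ^{⊗3}(Φ)`, which is invertible because `ξ` is an algebra
map. Injectivity of `ζ` makes splittings unique, which gives functoriality of `(-)^•` and
compatibility of `ξ` with reassociators. The adjunction is then the underlying one, since its unit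
and counit preserve reassociators. -/

namespace QuasiDual

open CoalgebraStruct LinearMap WithConv

section Pairings

variable {k : Type*} [Field k]

/-! ### Tensor products of pairings and their adjoint maps. -/

section TensorPairing

variable {A B E A' B' C D F C' D' : Type*}
  [AddCommGroup A] [Module k A] [AddCommGroup B] [Module k B] [AddCommGroup E] [Module k E]
  [AddCommGroup A'] [Module k A'] [AddCommGroup B'] [Module k B']
  [AddCommGroup C] [Module k C] [AddCommGroup D] [Module k D] [AddCommGroup F] [Module k F]
  [AddCommGroup C'] [Module k C'] [AddCommGroup D'] [Module k D']

/-- The tensor product of two bilinear pairings. -/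
noncomputable def tensorPairing (θ : A →ₗ[k] Module.Dual k C) (ψ : B →ₗ[k] Module.Dual k D) :
    A ⊗[k] B →ₗ[k] Module.Dual k (C ⊗[k] D) :=
  dualDistrib k C D ∘ₗ TensorProduct.map θ ψ

/-- This is the shape in which `ε ⊗ ω` and `ω ⊗ ε` occur in `IsDualReassociator`. -/
theorem tensorPairing_tmul (θ : A →ₗ[k] Module.Dual k C) (ψ : B →ₗ[k] Module.Dual k D)
    (a : A) (b : B) :
    tensorPairing θ ψ (a ⊗ₜ b) = mul' k k ∘ₗ TensorProduct.map (θ a) (ψ b) :=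
  TensorProduct.ext' fun _ _ => rfl

@[simp]
theorem tensorPairing_tmul_tmul (θ : A →ₗ[k] Module.Dual k C) (ψ : B →ₗ[k] Module.Dual k D)
    (a : A) (b : B) (c : C) (d : D) :
    tensorPairing θ ψ (a ⊗ₜ b) (c ⊗ₜ d) = θ a c * ψ b d := rfl

/-- Adjointness is inherited by tensor products: `hf` and `hg` say that `f, f'` and `g, g'` are
adjoint for the pairings. Structure maps applied to `Φ` thereby become precompositions of `ω` with
their duals. -/
theorem tensorPairing_map {θ : A →ₗ[k] Module.Dual k C} {ψ : B →ₗ[k] Module.Dual k D}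
    {θ' : A' →ₗ[k] Module.Dual k C'} {ψ' : B' →ₗ[k] Module.Dual k D'}
    {f : A →ₗ[k] A'} {f' : C' →ₗ[k] C} {g : B →ₗ[k] B'} {g' : D' →ₗ[k] D}
    (hf : ∀ a, θ' (f a) = θ a ∘ₗ f') (hg : ∀ b, ψ' (g b) = ψ b ∘ₗ g') (t : A ⊗[k] B) :
    tensorPairing θ' ψ' (TensorProduct.map f g t) =
      tensorPairing θ ψ t ∘ₗ TensorProduct.map f' g' := by
  induction t with
  | zero => simp
  | add x y hx hy => rw [map_add, map_add, hx, hy, map_add, LinearMap.add_comp]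
  | tmul a b => ext c d; simp [hf, hg]

theorem tensorPairing_lTensor {θ : A →ₗ[k] Module.Dual k C} {ψ : B →ₗ[k] Module.Dual k D}
    {ψ' : B' →ₗ[k] Module.Dual k D'} {g : B →ₗ[k] B'} {g' : D' →ₗ[k] D}
    (hg : ∀ b, ψ' (g b) = ψ b ∘ₗ g') (t : A ⊗[k] B) :
    tensorPairing θ ψ' (lTensor A g t) = tensorPairing θ ψ t ∘ₗ lTensor C g' :=
  tensorPairing_map (fun _ => rfl) hg t

theorem tensorPairing_rTensor {θ : A →ₗ[k] Module.Dual k C} {ψ : B →ₗ[k] Module.Dual k D}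
    {θ' : A' →ₗ[k] Module.Dual k C'} {f : A →ₗ[k] A'} {f' : C' →ₗ[k] C}
    (hf : ∀ a, θ' (f a) = θ a ∘ₗ f') (t : A ⊗[k] B) :
    tensorPairing θ' ψ (rTensor B f t) = tensorPairing θ ψ t ∘ₗ rTensor D f' :=
  tensorPairing_map hf (fun _ => rfl) t

/-- The adjoint of the associator is the inverse associator, by associativity of multiplication in
`k`. -/
theorem tensorPairing_assoc (θ : A →ₗ[k] Module.Dual k C) (ψ : B →ₗ[k] Module.Dual k D)
    (χ : E →ₗ[k] Module.Dual k F) (t : (A ⊗[k] B) ⊗[k] E) :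
    tensorPairing θ (tensorPairing ψ χ) (TensorProduct.assoc k A B E t) =
      tensorPairing (tensorPairing θ ψ) χ t ∘ₗ (TensorProduct.assoc k C D F).symm.toLinearMap := by
  suffices h : tensorPairing θ (tensorPairing ψ χ) ∘ₗ (TensorProduct.assoc k A B E).toLinearMap =
      LinearMap.lcomp k k (TensorProduct.assoc k C D F).symm.toLinearMap ∘ₗ
        tensorPairing (tensorPairing θ ψ) χ from LinearMap.congr_fun h t
  ext a b e c d f
  simp [mul_assoc]

/-- If `e` is evaluation at `c`, contracting a leg with `e` is adjoint to inserting `c`. It is used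
with `e = ε` and `c = 1`. -/
theorem tensorPairing_lid {θ : A →ₗ[k] Module.Dual k C} (ψ : B →ₗ[k] Module.Dual k D)
    {c : C} {e : A →ₗ[k] k} (he : ∀ a, θ a c = e a) (t : A ⊗[k] B) :
    ψ (TensorProduct.lid k B (rTensor B e t)) = tensorPairing θ ψ t ∘ₗ TensorProduct.mk k C D c := by
  induction t with
  | zero => simp
  | add x y hx hy => simp only [map_add, hx, hy, LinearMap.add_comp]
  | tmul a b => ext d; simp [he]

theorem tensorPairing_rid (θ : A →ₗ[k] Module.Dual k C) {ψ : B →ₗ[k] Module.Dual k D}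
    {d : D} {e : B →ₗ[k] k} (he : ∀ b, ψ b d = e b) (t : A ⊗[k] B) :
    θ (TensorProduct.rid k A (lTensor A e t)) =
      tensorPairing θ ψ t ∘ₗ (TensorProduct.mk k C D).flip d := by
  induction t with
  | zero => simp
  | add x y hx hy => simp only [map_add, hx, hy, LinearMap.add_comp]
  | tmul a b => ext c; simp [he, mul_comm]

end TensorPairing

/-! ### Pairings that are algebra maps into convolution algebras. -/

section Convolution

variable {A B C D : Type*} [Ring A] [Algebra k A] [Ring B] [Algebra k B]
  [AddCommGroup C] [Module k C] [Coalgebra k C] [AddCommGroup D] [Module k D] [Coalgebra k D]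

/-- A pairing of an algebra with a coalgebra which induces a unital algebra homomorphism to the
convolution algebra of functionals. -/
structure IsConvPairing (θ : A →ₗ[k] Module.Dual k C) : Prop where
  map_one : θ 1 = counit
  map_mul : ∀ a b, toConv (θ (a * b)) = toConv (θ a) * toConv (θ b)

theorem toConv_counit : toConv (counit : C →ₗ[k] k) = 1 := rfl

/-- Convolution of tensor products of maps is componentwise, and multiplication `k ⊗ k → k` is an
algebra map because `k` is commutative, so it commutes with convolution. -/
theorem toConv_tensor_mul (f h : C →ₗ[k] k) (g l : D →ₗ[k] k) :
    toConv (mul' k k ∘ₗ TensorProduct.map f g) * toConv (mul' k k ∘ₗ TensorProduct.map h l) =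
      toConv (mul' k k ∘ₗ TensorProduct.map (toConv f * toConv h).ofConv
        (toConv g * toConv l).ofConv) := by
  have h1 := algHom_comp_convMul_distrib (R := k) (C := C ⊗[k] D) (Algebra.TensorProduct.lmul' k)
    (toConv (TensorProduct.map f g)) (toConv (TensorProduct.map h l))
  have h2 := TensorProduct.map_convMul_map (f := toConv f) (h := toConv h) (g := toConv g)
    (k := toConv l)
  apply ofConv_injective
  refine Eq.trans h1.symm ?_
  exact congrArg (fun w => (Algebra.TensorProduct.lmul' k).toLinearMap ∘ₗ w.ofConv) h2

/-- By bilinearity it is enough to multiply pure tensors. Iteration gives the third power, where `Φ`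
lives, and the fourth, where the cocycle condition lives. -/
theorem IsConvPairing.tensor {θ : A →ₗ[k] Module.Dual k C} {ψ : B →ₗ[k] Module.Dual k D}
    (hθ : IsConvPairing θ) (hψ : IsConvPairing ψ) : IsConvPairing (tensorPairing θ ψ) where
  map_one := by
    rw [Algebra.TensorProduct.one_def, tensorPairing_tmul, hθ.map_one, hψ.map_one]
    ext c d
    simp [mul_comm]
  map_mul s t := by
    induction s with
    | zero => simp
    | add x y hx hy => simp only [add_mul, map_add, toConv_add, hx, hy]
    | tmul a b =>
      induction t with
      | zero => simp
      | add x y hx hy => simp only [mul_add, map_add, toConv_add, hx, hy]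
      | tmul a' b' =>
        simp only [Algebra.TensorProduct.tmul_mul_tmul, tensorPairing_tmul]
        rw [toConv_tensor_mul, ← hθ.map_mul, ← hψ.map_mul]

theorem IsConvPairing.isUnit {θ : A →ₗ[k] Module.Dual k C} (hθ : IsConvPairing θ) {a : A}
    (ha : IsUnit a) : IsUnit (toConv (θ a)) := by
  obtain ⟨⟨a, b, hab, hba⟩, rfl⟩ := ha
  refine ⟨⟨toConv (θ a), toConv (θ b), ?_, ?_⟩, rfl⟩
  · rw [← hθ.map_mul, hab, hθ.map_one, toConv_counit]
  · rw [← hθ.map_mul, hba, hθ.map_one, toConv_counit]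

/-- Since `1` is a unit and `f` is linear, `f` pulls the scalar `ω(x₁)` out of `ω(x₁)1 · g(x₂)`.
Associativity of `U` plays no role, so this reduces the `U`-valued axiom `quasi_assoc` to scalar
convolutions. -/
theorem comp_smulOne_mul {U : Type*} [NonAssocRing U] [Module k U] [SMulCommClass k U U]
    [IsScalarTower k U U] (f : U →ₗ[k] k) (ω : C →ₗ[k] k) (g : C →ₗ[k] U) :
    f ∘ₗ (toConv (toSpanSingleton k U 1 ∘ₗ ω) * toConv g).ofConv =
      (toConv ω * toConv (f ∘ₗ g)).ofConv := by
  ext x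
  simp only [LinearMap.convMul_def, LinearMap.comp_apply]
  generalize comul (R := k) x = t
  induction t with
  | zero => simp
  | add x y hx hy => simp only [map_add, hx, hy]
  | tmul x y => simp

theorem comp_mul_smulOne {U : Type*} [NonAssocRing U] [Module k U] [SMulCommClass k U U]
    [IsScalarTower k U U] (f : U →ₗ[k] k) (ω : C →ₗ[k] k) (g : C →ₗ[k] U) :
    f ∘ₗ (toConv g * toConv (toSpanSingleton k U 1 ∘ₗ ω)).ofConv =
      (toConv (f ∘ₗ g) * toConv ω).ofConv := by
  ext x
  simp only [LinearMap.convMul_def, LinearMap.comp_apply]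
  generalize comul (R := k) x = t
  induction t with
  | zero => simp
  | add x y hx hy => simp only [map_add, hx, hy]
  | tmul x y => simp [mul_comm]

end Convolution

/-! ### Transfer of reassociator axioms along a pairing. -/

section Bialgebra

variable {A C : Type*} [Ring A] [Algebra k A] [CoalgebraStruct k A]
  [NonAssocRing C] [Module k C] [SMulCommClass k C C] [IsScalarTower k C C] [Coalgebra k C]

/-- A pairing for which multiplication and unit on each side are dual to comultiplication and
counit on the other side. -/
structure IsBialgPairing (θ : A →ₗ[k] Module.Dual k C) : Prop extends IsConvPairing θ where
  apply_one : ∀ a, θ a 1 = counit (R := k) a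
  comp_mul : ∀ a, tensorPairing θ θ (comul a) = θ a ∘ₗ mul' k C

/-- The third tensor power of a pairing. -/
noncomputable abbrev cubePairing (θ : A →ₗ[k] Module.Dual k C) :
    A ⊗[k] (A ⊗[k] A) →ₗ[k] Module.Dual k (C ⊗[k] (C ⊗[k] C)) :=
  tensorPairing θ (tensorPairing θ θ)

namespace IsBialgPairing

variable {θ : A →ₗ[k] Module.Dual k C} (hθ : IsBialgPairing θ)
include hθ

theorem square : IsConvPairing (tensorPairing θ θ) := hθ.toIsConvPairing.tensor hθ.toIsConvPairing

theorem cube : IsConvPairing (cubePairing θ) := hθ.toIsConvPairing.tensor hθ.square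

theorem fourth : IsConvPairing (k := k) (A := A ⊗[k] (A ⊗[k] (A ⊗[k] A)))
    (C := C ⊗[k] (C ⊗[k] (C ⊗[k] C))) (tensorPairing θ (cubePairing θ)) :=
  hθ.toIsConvPairing.tensor hθ.cube

/-- The fourth power of `θ` is multiplicative, and in each factor `Δ` is traded for `m` on the dual
side. -/
theorem cocycle_left (Φ : A ⊗[k] (A ⊗[k] A)) :
    toConv (tensorPairing θ (cubePairing θ) (lTensor A (lTensor A comul) Φ *
      TensorProduct.assoc k A A (A ⊗[k] A) (rTensor (A ⊗[k] A) comul Φ))) =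
    toConv (cubePairing θ Φ ∘ₗ lTensor C (lTensor C (mul' k C))) *
      toConv (cubePairing θ Φ ∘ₗ rTensor (C ⊗[k] C) (mul' k C) ∘ₗ
        (TensorProduct.assoc k C C (C ⊗[k] C)).symm.toLinearMap) := by
  rw [hθ.fourth.map_mul, tensorPairing_lTensor (tensorPairing_lTensor hθ.comp_mul),
    tensorPairing_assoc, tensorPairing_rTensor hθ.comp_mul]
  rfl

theorem cocycle_right (Φ : A ⊗[k] (A ⊗[k] A)) :
    toConv (tensorPairing θ (cubePairing θ) ((1 ⊗ₜ[k] Φ) *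
      lTensor A ((TensorProduct.assoc k A A A).toLinearMap ∘ₗ rTensor A comul) Φ *
      lTensor A (TensorProduct.assoc k A A A).toLinearMap
        (TensorProduct.assoc k A (A ⊗[k] A) A (Φ ⊗ₜ[k] 1)))) =
    toConv (mul' k k ∘ₗ TensorProduct.map counit (cubePairing θ Φ)) *
      toConv (cubePairing θ Φ ∘ₗ lTensor C
        (rTensor C (mul' k C) ∘ₗ (TensorProduct.assoc k C C C).symm.toLinearMap)) *
      toConv (mul' k k ∘ₗ TensorProduct.map (cubePairing θ Φ) counit ∘ₗ
        (TensorProduct.assoc k C (C ⊗[k] C) C).symm.toLinearMap ∘ₗ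
          lTensor C (TensorProduct.assoc k C C C).symm.toLinearMap) := by
  rw [hθ.fourth.map_mul, hθ.fourth.map_mul, tensorPairing_tmul, hθ.map_one]
  congr 1
  · congr 2
    -- Middle factor: `Δ` acts on the second leg, and the rebracketing after it becomes the inverse
    -- associator before `m`.
    exact tensorPairing_lTensor (fun b => by
      rw [LinearMap.comp_apply, LinearEquiv.coe_coe, tensorPairing_assoc,
        tensorPairing_rTensor hθ.comp_mul]; rfl) Φ
  -- Last factor: the tail must be paired in the bracketing `(θ ⊗ θ) ⊗ θ` before the outer
  -- associator can be moved across; then `θ 1 = ε` turns `Φ ⊗ 1` into `ω ⊗ ε`.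
  · rw [tensorPairing_lTensor (ψ := tensorPairing (tensorPairing θ θ) θ)
      (tensorPairing_assoc θ θ θ), tensorPairing_assoc, tensorPairing_tmul, hθ.map_one]
    rfl

/-- One side of quasi-coassociativity at `a` is one side of `quasi_assoc` tested against `θ a`,
because `θ a` precomposed with an iterated product is the pairing with the iterated coproduct of
`a`. -/
theorem quasi_left (Φ : A ⊗[k] (A ⊗[k] A)) (a : A) :
    cubePairing θ (Φ * TensorProduct.assoc k A A A (rTensor A comul (comul a))) =
      θ a ∘ₗ (toConv (toSpanSingleton k C 1 ∘ₗ cubePairing θ Φ) *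
        toConv (mul' k C ∘ₗ rTensor C (mul' k C) ∘ₗ
          (TensorProduct.assoc k C C C).symm.toLinearMap)).ofConv := by
  rw [comp_smulOne_mul]
  apply toConv_injective
  rw [hθ.cube.map_mul, tensorPairing_assoc, tensorPairing_rTensor hθ.comp_mul, hθ.comp_mul]
  rfl

theorem quasi_right (Φ : A ⊗[k] (A ⊗[k] A)) (a : A) :
    cubePairing θ (lTensor A comul (comul a) * Φ) =
      θ a ∘ₗ (toConv (mul' k C ∘ₗ lTensor C (mul' k C)) *
        toConv (toSpanSingleton k C 1 ∘ₗ cubePairing θ Φ)).ofConv := by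
  rw [comp_mul_smulOne]
  apply toConv_injective
  rw [hθ.cube.map_mul, tensorPairing_lTensor hθ.comp_mul, hθ.comp_mul]
  rfl

/-- Since `ε` is evaluation at `1`, applying `ε` to a leg of `Φ` amounts to inserting `1` in that
argument of `ω`; likewise for the other two legs. -/
theorem counit_left_apply (Φ : A ⊗[k] (A ⊗[k] A)) (x y : C) :
    tensorPairing θ θ (TensorProduct.lid k (A ⊗[k] A) (rTensor (A ⊗[k] A) counit Φ)) (x ⊗ₜ y) =
      cubePairing θ Φ (1 ⊗ₜ (x ⊗ₜ y)) := by
  rw [tensorPairing_lid _ hθ.apply_one]; rfl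

theorem counit_middle_apply (Φ : A ⊗[k] (A ⊗[k] A)) (x y : C) :
    tensorPairing θ θ (lTensor A ((TensorProduct.lid k A).toLinearMap ∘ₗ rTensor A counit) Φ)
      (x ⊗ₜ y) = cubePairing θ Φ (x ⊗ₜ (1 ⊗ₜ y)) := by
  rw [tensorPairing_lTensor (tensorPairing_lid θ hθ.apply_one)]; rfl

theorem counit_right_apply (Φ : A ⊗[k] (A ⊗[k] A)) (x y : C) :
    tensorPairing θ θ (lTensor A ((TensorProduct.rid k A).toLinearMap ∘ₗ lTensor A counit) Φ)
      (x ⊗ₜ y) = cubePairing θ Φ (x ⊗ₜ (y ⊗ₜ 1)) := by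
  rw [tensorPairing_lTensor (tensorPairing_rid θ hθ.apply_one)]; rfl

theorem square_one_apply (x y : C) :
    tensorPairing θ θ (1 ⊗ₜ 1) (x ⊗ₜ y) = counit (R := k) x * counit (R := k) y := by
  rw [tensorPairing_tmul_tmul, hθ.map_one]

/-- A reassociator of `A` gives a dual reassociator of `C`, if `A` separates the points of `C`. -/
theorem isDualReassociator (hsep : ∀ x y : C, (∀ a, θ a x = θ a y) → x = y)
    {Φ : A ⊗[k] (A ⊗[k] A)} (hΦ : IsReassociator k A Φ) :
    IsDualReassociator k C (cubePairing θ Φ) where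
  isUnit := hθ.cube.isUnit hΦ.isUnit
  cocycle := by rw [← hθ.cocycle_left, hΦ.cocycle, hθ.cocycle_right]
  unit_left x y := by rw [← hθ.counit_left_apply, hΦ.counit_left, hθ.square_one_apply]
  unit_middle x y := by rw [← hθ.counit_middle_apply, hΦ.counit_middle, hθ.square_one_apply]
  unit_right x y := by rw [← hθ.counit_right_apply, hΦ.counit_right, hθ.square_one_apply]
  quasi_assoc := by
    apply ofConv_injective
    -- This is the only axiom with values in `C` instead of `k`, hence the only one that needs
    -- `hsep`.
    refine LinearMap.ext fun x => hsep _ _ fun a => ?_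
    refine (LinearMap.congr_fun (hθ.quasi_left Φ a) x).symm.trans ?_
    rw [hΦ.quasi_coassoc, hθ.quasi_right]
    rfl

/-- An invertible element which induces a dual reassociator of `C` is a reassociator of `A`, if
`C` separates the points of `A`. -/
theorem isReassociator (hinj : Function.Injective θ) {Φ : A ⊗[k] (A ⊗[k] A)} (hΦ : IsUnit Φ)
    (hω : IsDualReassociator k C (cubePairing θ Φ)) : IsReassociator k A Φ := by
  -- Freeness gives flatness, so tensor powers of the injective `θ` stay injective. The second power
  -- detects the counit axioms, the third quasi-coassociativity, the fourth the cocycle condition.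
  have h1 : Module.Free k A := Module.Free.of_divisionRing k A
  have h2 : Function.Injective (tensorPairing θ θ) := dualDistrib_injective.comp
    (TensorProduct.map_injective_of_flat_flat' _ _ hinj hinj)
  have h3 : Function.Injective (cubePairing θ) := dualDistrib_injective.comp
    (TensorProduct.map_injective_of_flat_flat' _ _ hinj h2)
  have h4 : Function.Injective (tensorPairing θ (cubePairing θ)) := dualDistrib_injective.comp
    (TensorProduct.map_injective_of_flat_flat' _ _ hinj h3)
  refine ⟨hΦ, ?_, ?_, ?_, ?_, fun a => ?_⟩
  · apply h4
    apply toConv_injective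
    rw [hθ.cocycle_left, hω.cocycle, hθ.cocycle_right]
  · refine h2 (TensorProduct.ext' fun x y => ?_)
    rw [hθ.counit_left_apply, hω.unit_left, hθ.square_one_apply]
  · refine h2 (TensorProduct.ext' fun x y => ?_)
    rw [hθ.counit_middle_apply, hω.unit_middle, hθ.square_one_apply]
  · refine h2 (TensorProduct.ext' fun x y => ?_)
    rw [hθ.counit_right_apply, hω.unit_right, hθ.square_one_apply]
  · apply h3
    rw [hθ.quasi_left, hω.quasi_assoc, hθ.quasi_right]

end IsBialgPairing

end Bialgebra

end Pairings


/-! ### The two evaluation pairings and the naturality of `ζ`. -/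

section Evaluation

variable {k : Type*} [Field k]

/-- Product, unit and counit of `U^•` are defined through evaluation, so those conditions are
definitional; the last one is the formula characterising the comultiplication of `U^•`. -/
theorem isBialgPairing_toDual (U : Type*) [NonAssocRing U] [Module k U] [SMulCommClass k U U]
    [IsScalarTower k U U] [Coalgebra k U] [NonassocBialgebra k U] :
    IsBialgPairing (FiniteDual.toDual k U) where
  map_one := rfl
  map_mul _ _ := rfl
  apply_one _ := rfl
  comp_mul f := TensorProduct.ext' fun x y => FiniteDual.pair_comul f x y

/-- With the roles exchanged, multiplicativity becomes `f(ab) = ∑ f₁(a) f₂(b)`, and duality of `Δ`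
with the product of `H^∘` is the definition of convolution. -/
theorem isBialgPairing_toDual_flip (H : Type*) [Ring H] [Algebra k H] [CoalgebraStruct k H]
    [NonassocBialgebra k H] : IsBialgPairing (FiniteDual.toDual k H).flip where
  map_one := rfl
  map_mul a b := by
    ext f
    change f (a * b) = mul' k k (TensorProduct.map ((FiniteDual.toDual k H).flip a)
      ((FiniteDual.toDual k H).flip b) (comul f))
    rw [← FiniteDual.pair_comul]
    generalize comul (R := k) f = t
    induction t with
    | zero => simp
    | add x y hx hy => simp_all
    | tmul f g => simp
  apply_one _ := rfl
  comp_mul a := TensorProduct.ext' fun f g => FiniteDual.eval_aux _ f g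

/-- This identifies `dualω` as the image of `Φ` under the cube of the evaluation pairing, so that
the transfer theorem applies. -/
theorem zeta_flip (H : Type*) [Ring H] [Algebra k H] [CoalgebraStruct k H]
    [NonassocBialgebra k H] :
    (FiniteDual.zeta k H).flip = cubePairing (FiniteDual.toDual k H).flip := by
  ext a b c f g h
  rfl

namespace FiniteDual

variable {V W : Type*}
  [NonAssocRing V] [Module k V] [SMulCommClass k V V] [IsScalarTower k V V] [CoalgebraStruct k V]
  [NonAssocRing W] [Module k W] [SMulCommClass k W W] [IsScalarTower k W W] [CoalgebraStruct k W]

/-- Precomposition with `f` is adjoint to `f` in each of the three legs. -/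
theorem zeta_tensorCube_mapLinear (f : NonassocBialgHom k V W)
    (t : FiniteDual k W ⊗[k] (FiniteDual k W ⊗[k] FiniteDual k W)) :
    zeta k V (tensorCube (mapLinear f) t) = zeta k W t ∘ₗ tensorCube f.toLinearMap :=
  tensorPairing_map (fun _ => rfl) (tensorPairing_map (fun _ => rfl) fun _ => rfl) t

theorem zeta_flip_tensorCube (f : NonassocBialgHom k V W) (t : V ⊗[k] (V ⊗[k] V)) :
    (zeta k W).flip (tensorCube f.toLinearMap t) =
      (zeta k V).flip t ∘ₗ tensorCube (mapLinear f) :=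
  LinearMap.ext fun s => (LinearMap.congr_fun (zeta_tensorCube_mapLinear f s) t).symm

variable [NonassocBialgebra k V]

/-- On pure tensors both sides evaluate three functionals at three vectors. For `t = Φ` this
exhibits the reassociator of `H^∘` as `ζ(ξ^{⊗3}(Φ))`, which is the source of splitness. -/
theorem zeta_tensorCube_eval (t : V ⊗[k] (V ⊗[k] V)) :
    zeta k (FiniteDual k V) (tensorCube (eval k V).toLinearMap t) = (zeta k V).flip t := by
  suffices h : zeta k (FiniteDual k V) ∘ₗ tensorCube (eval k V).toLinearMap = (zeta k V).flip from
    LinearMap.congr_fun h t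
  ext a b c f g h
  rfl

/-- The preceding identity read as a function of the other variable; it makes `ϑ_U` preserve
reassociators. -/
theorem zeta_flip_comp_tensorCube_eval
    (t : FiniteDual k V ⊗[k] (FiniteDual k V ⊗[k] FiniteDual k V)) :
    (zeta k (FiniteDual k V)).flip t ∘ₗ tensorCube (eval k V).toLinearMap = zeta k V t :=
  LinearMap.ext fun s => LinearMap.congr_fun (zeta_tensorCube_eval s) t

end FiniteDual

/-- A unital multiplicative linear map sends invertible elements of the triple tensor power to
invertible elements. -/
theorem isUnit_tensorCube {A B : Type*} [Ring A] [Algebra k A] [Ring B] [Algebra k B]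
    (f : A →ₐ[k] B) {Φ : A ⊗[k] (A ⊗[k] A)} (hΦ : IsUnit Φ) :
    IsUnit (tensorCube f.toLinearMap Φ) :=
  hΦ.map (Algebra.TensorProduct.map f (Algebra.TensorProduct.map f f))

end Evaluation

/-! ### The functors and the adjunction. -/

section Main

variable {k : Type u} [Field k]

/-- Separation is automatic: elements of `H^∘` are functionals on `H`. -/
theorem QuasiBialgebra.isDualReassociator (H : QuasiBialgebra k) :
    IsDualReassociator k (FiniteDual k H.base) H.dualω := by
  rw [QuasiBialgebra.dualω, zeta_flip]
  exact (isBialgPairing_toDual_flip H.base).isDualReassociator (fun _ _ h => FiniteDual.ext h)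
    H.isReassociator

theorem QuasiBialgebra.dualω_comp {H K : QuasiBialgebra k} (f : H ⟶ K) :
    H.dualω ∘ₗ tensorCube (FiniteDual.map f.hom).toLinearMap = K.dualω := by
  rw [QuasiBialgebra.dualω, QuasiBialgebra.dualω, ← f.map_reassociator]
  exact (FiniteDual.zeta_flip_tensorCube (V := H.base) (W := K.base) f.hom H.Φ).symm

theorem QuasiBialgebra.isUnit_eval (H : QuasiBialgebra k) :
    IsUnit (tensorCube (FiniteDual.eval k H.base).toLinearMap H.Φ) :=
  isUnit_tensorCube (AlgHom.ofLinearMap (FiniteDual.eval k H.base).toLinearMap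
    (FiniteDual.eval k H.base).map_one' (FiniteDual.eval k H.base).map_mul')
    H.isReassociator.isUnit

theorem QuasiBialgebra.isSplitting_eval (H : QuasiBialgebra k) :
    DualQuasiBialgebra.IsSplitting
      ((quasiCirc QuasiBialgebra.isDualReassociator QuasiBialgebra.dualω_comp).obj (.op H))
      (tensorCube (FiniteDual.eval k H.base).toLinearMap H.Φ) where
  isUnit := H.isUnit_eval
  zeta_eq := FiniteDual.zeta_tensorCube_eval H.Φ

/-- Invertibility of `Φ` comes from the splitting: a convolution inverse of `ω` is not given as an
element of the image of `ζ`. -/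
theorem DualQuasiBialgebra.IsSplitting.isReassociator (U : DualQuasiBialgebra k)
    (Φ : FiniteDual k U.base ⊗[k] (FiniteDual k U.base ⊗[k] FiniteDual k U.base))
    (h : U.IsSplitting Φ) : IsReassociator k (FiniteDual k U.base) Φ := by
  refine (isBialgPairing_toDual U.base).isReassociator FiniteDual.toDual_injective h.isUnit ?_
  have := U.isReassociator
  rwa [← h.zeta_eq] at this

/-- The elements `Φ` are only chosen, so they are compared after the injective `ζ`, where the claim
becomes `ω_V ∘ g^{⊗3} = ω_U`. -/
theorem SplitDualQuasiBialgebra.tensorCube_map_Φ {U V : SplitDualQuasiBialgebra k} (g : U ⟶ V) :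
    tensorCube (FiniteDual.map g.hom.hom).toLinearMap (SplitDualQuasiBialgebra.Φ V) =
      SplitDualQuasiBialgebra.Φ U := by
  apply FiniteDual.zeta_injective
  refine (FiniteDual.zeta_tensorCube_mapLinear g.hom.hom _).trans ?_
  rw [(SplitDualQuasiBialgebra.isSplitting U).zeta_eq,
    (SplitDualQuasiBialgebra.isSplitting V).zeta_eq, ← g.hom.comp_reassociator]

/-- The contravariant functor from quasi-bialgebras to split dual quasi-bialgebras. -/
noncomputable abbrev splitCirc (k : Type u) [Field k] :
    (QuasiBialgebra k)ᵒᵖ ⥤ SplitDualQuasiBialgebra k :=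
  (isSplit k).lift (quasiCirc QuasiBialgebra.isDualReassociator QuasiBialgebra.dualω_comp)
    fun H => ⟨_, H.unop.isSplitting_eval⟩

/-- The contravariant functor from split dual quasi-bialgebras to quasi-bialgebras. -/
noncomputable abbrev splitBullet (k : Type u) [Field k] :
    (SplitDualQuasiBialgebra k)ᵒᵖ ⥤ QuasiBialgebra k :=
  quasiBullet DualQuasiBialgebra.IsSplitting.isReassociator
    SplitDualQuasiBialgebra.tensorCube_map_Φ

/-- The evaluation morphism `ξ_H`. -/
noncomputable def quasiEval (H : QuasiBialgebra k) :
    H ⟶ (splitBullet k).obj (.op ((splitCirc k).obj (.op H))) where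
  hom := FiniteDual.eval k H.base
  -- The target carries the chosen splitting of `H^∘`; by uniqueness it equals `ξ^{⊗3}(Φ)`.
  map_reassociator :=
    SplitDualQuasiBialgebra.eq_Φ ((splitCirc k).obj (.op H)) H.isSplitting_eval

/-- The evaluation morphism `ϑ_U`. -/
noncomputable def dualQuasiEval (U : SplitDualQuasiBialgebra k) :
    U ⟶ (splitCirc k).obj (.op ((splitBullet k).obj (.op U))) :=
  ObjectProperty.homMk
    { hom := FiniteDual.eval k U.obj.base
      comp_reassociator :=
        (FiniteDual.zeta_flip_comp_tensorCube_eval (SplitDualQuasiBialgebra.Φ U)).trans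
          (SplitDualQuasiBialgebra.isSplitting U).zeta_eq }

/-- The contravariant adjunction between quasi-bialgebras and split dual quasi-bialgebras. -/
noncomputable def quasiAdjunction (k : Type u) [Field k] :
    (splitCirc k).rightOp ⊣ splitBullet k where
  unit :=
    { app := fun H => quasiEval H
      naturality := fun _ _ _ => rfl }
  counit :=
    { app := fun U => (dualQuasiEval U.unop).op
      naturality := fun _ _ _ => rfl }
  -- Morphisms are determined by their underlying maps, and evaluating and then restricting along
  -- evaluation returns the original functional definitionally.
  left_triangle_components _ := rfl
  right_triangle_components _ := rfl

end Main

end QuasiDual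

theorem mainTheorem1 (k : Type u) [Field k] :
    ∃ (hcirc : ∀ H : QuasiBialgebra k, IsDualReassociator k (FiniteDual k H.base) H.dualω)
      (hcircMap : ∀ {H K : QuasiBialgebra k} (f : H ⟶ K),
        H.dualω ∘ₗ tensorCube (FiniteDual.map f.hom).toLinearMap = K.dualω)
      (hsplit : ∀ H, isSplit k ((quasiCirc hcirc hcircMap).obj H))
      (hbullet : ∀ (U : DualQuasiBialgebra k) Φ, U.IsSplitting Φ →
        IsReassociator k (FiniteDual k U.base) Φ)
      (hbulletMap : ∀ {U V : SplitDualQuasiBialgebra k} (g : U ⟶ V),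
        tensorCube (FiniteDual.map g.hom.hom).toLinearMap (SplitDualQuasiBialgebra.Φ V) =
          SplitDualQuasiBialgebra.Φ U)
      (adj : ((isSplit k).lift (quasiCirc hcirc hcircMap) hsplit).rightOp ⊣
        quasiBullet hbullet hbulletMap),
      (∀ H : QuasiBialgebra k, (QuasiBialgebra.forget k).map (adj.unit.app H) =
        (finiteDualAdjunction k).unit.app H.base) ∧
      (∀ U : SplitDualQuasiBialgebra k,
        ((isSplit k).ι ⋙ DualQuasiBialgebra.forget k).map (adj.counit.app (.op U)).unop =
          ((finiteDualAdjunction k).counit.app (.op U.obj.base)).unop) :=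
  ⟨QuasiBialgebra.isDualReassociator, QuasiBialgebra.dualω_comp,
    fun H => ⟨_, H.unop.isSplitting_eval⟩, DualQuasiBialgebra.IsSplitting.isReassociator,
    SplitDualQuasiBialgebra.tensorCube_map_Φ, quasiAdjunction k, fun _ => rfl, fun _ => rfl⟩
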